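/- \textbf{Exponential Caching.} Let $w\ge 1$ be an integer and let $U$ be a universe of $n=2^w-1$ elements. A (valid) partitioning is a map $p:U\to\{0,\dots,w-1\}$ with $|p^{-1}(i)|=2^i$ for every $i$; write $\mathrm{size}(p,x)=2^{p(x)}$ for the cardinality of the chunk containing $x$. An input $\mathcal I$ consists of an initial partitioning $p_0$ and a finite sequence of nonempty sets $R_1,\dots,R_m\subseteq U$. In step $t$, when $R_t$ arrives, an algorithm pays the access cost $\min_{x\in R_t}\mathrm{size}(p_{t-1},x)$ and then chooses a partitioning $p_t$, paying the movement cost $\sum_{x:\,p_t(x)\ne p_{t-1}(x)}\max\{\mathrm{size}(p_{t-1},x),\mathrm{size}(p_t,x)\}$. A deterministic online algorithm chooses $p_t$ as a function of $p_0,R_1,\dots,R_t$ only (in particular without knowing $m$, the later sets, or a bound on their cardinalities). Let $\mathrm{Alg}(\mathcal I)$ be its total cost, let $\mathrm{Opt}(\mathcal I)$ be the minimum total cost over all sequences $p_1,\dots,p_m$ of partitionings, and let $r(\mathcal I)=\max_t|R_t|$ (with $r(\mathcal I)=0$ if $m=0$). \textbf{Corollary.} There exists a deterministic $O(r^4)$-competitive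 online algorithm for the Exponential Caching problem: there are absolute constants $C$ and $\xi$ such that for every $w\ge1$ and every universe $U$ with $2^w-1$ elements there is a deterministic online algorithm $\mathrm{Alg}$ with $$\mathrm{Alg}(\mathcal I)\le C\cdot r(\mathcal I)^4\cdot\mathrm{Opt}(\mathcal I)+\xi\qquad\text{for every input }\mathcal I .$$ -/

import Mathlib

namespace ExpCaching

/-- A valid partitioning of the universe `U` into `w` chunks: a map `p : U → {0, …, w-1}` whose
`i`-th chunk has exactly `2 ^ i` elements. -/
structure Partitioning (U : Type*) [Fintype U] (w : ℕ) where
  /-- The chunk index of an element. -/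
  chunk : U → Fin w
  valid : ∀ i : Fin w, (Finset.univ.filter fun x => chunk x = i).card = 2 ^ (i : ℕ)

variable {U : Type*} [Fintype U] {w : ℕ}

/-- The cardinality of the chunk that contains `x`. -/
def Partitioning.size (p : Partitioning U w) (x : U) : ℕ := 2 ^ (p.chunk x : ℕ)

/-- A request: a nonempty set of elements of the universe. -/
abbrev Request (U : Type*) := {R : Finset U // R.Nonempty}

/-- The cost of accessing the requested set `R` in the partitioning `p`. -/
def accessCost (p : Partitioning U w) (R : Request U) : ℕ :=
  R.1.inf' R.2 fun x => p.size x

/-- The cost of changing the partitioning `p` to `q`: each element whose chunk index changes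
contributes the larger of the sizes of its old and its new chunk. -/
def movementCost (p q : Partitioning U w) : ℕ :=
  ∑ x ∈ Finset.univ.filter (fun x => p.chunk x ≠ q.chunk x), max (p.size x) (q.size x)

/-- An input: an initial partitioning and a finite sequence of requests. -/
structure Input (U : Type*) [Fintype U] (w : ℕ) where
  init : Partitioning U w
  requests : List (Request U)

/-- The largest cardinality of a requested set (`0` if there are no requests). -/
def Input.maxCard (I : Input U w) : ℕ :=
  Finset.univ.sup fun t : Fin I.requests.length => (I.requests.get t).1.card

/-- An (offline) solution for `I`: partitionings `p 0, p 1, …, p m`, where `m` is the number of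
requests and `p 0` is the initial partitioning. -/
structure Solution (I : Input U w) where
  p : Fin (I.requests.length + 1) → Partitioning U w
  start : p 0 = I.init

/-- The total cost of a solution: request number `t` is accessed in the partitioning held before
the step, and then the partitioning is changed. -/
def Solution.cost {I : Input U w} (s : Solution I) : ℕ :=
  ∑ t : Fin I.requests.length,
    (accessCost (s.p t.castSucc) (I.requests.get t) + movementCost (s.p t.castSucc) (s.p t.succ))

/-- The optimal offline cost. -/
noncomputable def opt (I : Input U w) : ℕ := ⨅ s : Solution I, s.cost

instance (I : Input U w) : Nonempty (Solution I) := ⟨⟨fun _ => I.init, rfl⟩⟩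

/-- The optimal offline cost is the minimum of the costs of the solutions. -/
theorem isLeast_opt (I : Input U w) :
    IsLeast (Set.range fun s : Solution I => s.cost) (opt I) :=
  ⟨Nat.sInf_mem (Set.range_nonempty _), fun _ h => Nat.sInf_le h⟩

/-- A deterministic online algorithm: given the initial partitioning, the list of the past requests
(oldest first) and the current request, it chooses the next partitioning. It sees neither the future
requests nor their number nor a bound on their cardinalities. -/
structure OnlineAlgorithm (U : Type*) [Fintype U] (w : ℕ) where
  next : Partitioning U w → List (Request U) → Request U → Partitioning U w

/-- The solution that an online algorithm produces on an input. -/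
def OnlineAlgorithm.run (A : OnlineAlgorithm U w) (I : Input U w) : Solution I where
  p := Fin.cases I.init fun t => A.next I.init (I.requests.take t) (I.requests.get t)
  start := rfl

/-- The total cost of an online algorithm on an input. -/
def OnlineAlgorithm.cost (A : OnlineAlgorithm U w) (I : Input U w) : ℕ := (A.run I).cost

/-- `A` is `c r`-competitive with additive constant `ξ`, where `r` is the maximum cardinality of the
requested sets of the input. -/
def OnlineAlgorithm.IsCompetitive (A : OnlineAlgorithm U w) (c : ℕ → ℝ) (ξ : ℝ) : Prop :=
  ∀ I : Input U w, (A.cost I : ℝ) ≤ c I.maxCard * opt I + ξ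

end ExpCaching

namespace ExpCaching

open Finset

/-! A memoryless randomized algorithm is `O(r^2)`-competitive, and an averaging argument
derandomizes it at the price of squaring the ratio.

On a request with access cost `l`, the randomized algorithm picks a uniform `x ∈ R` and, with
probability `l / size x`, fetches it to chunk 0 by swaps with random elements of the successive
smaller chunks. Its expected cost is then at most `5 * l`. The potential counts the elements lying
in chunks more than `c = 16 * r` times larger than the adversary's. If the adversary's cheapest
element `y` is such an element, it is chosen with probability at least `1 / r`, so the potential
drops by `l / r` on average, up to the damage done by displaced elements, which is small because few
elements sit in small chunks of the adversary. Otherwise `l` is at most `16 * r` times the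
adversary's access cost (`randomStep_amortized`).

This bound holds pointwise in the configurations of both players, so the adversary may itself be
random. The deterministic algorithm tracks the law of the randomized one, treats that as its
adversary, and minimizes scaled cost plus expected potential; the minimum is no worse than the
average over a random step (`Memory.inner_step`). Composing two ratios `160 * r ^ 2` gives `25600 *
r ^ 4`. The unknown `r` is replaced by the running maximum, since raising `c` only lowers the
potential. -/

/-- A finitely additive probability on `α`, given by its expectation functional. -/
structure Mean (α : Type*) where
  /-- The expectation. -/
  E : (α → ℝ) →ₗ[ℝ] ℝ
  mono : ∀ f g : α → ℝ, (∀ a, f a ≤ g a) → E f ≤ E g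
  one : E (fun _ => 1) = 1

/-! ### Calculus of expectations -/

namespace Mean

variable {α β : Type*}

theorem E_const (μ : Mean α) (c : ℝ) : μ.E (fun _ => c) = c := by
  have h : (fun _ : α => c) = c • (fun _ : α => (1 : ℝ)) := by ext; simp
  rw [h, map_smul, μ.one]; simp

theorem E_add (μ : Mean α) (f g : α → ℝ) : μ.E (fun a => f a + g a) = μ.E f + μ.E g :=
  map_add μ.E f g

theorem E_mul (μ : Mean α) (c : ℝ) (f : α → ℝ) : μ.E (fun a => c * f a) = c * μ.E f :=
  map_smul μ.E c f

theorem E_div (μ : Mean α) (c : ℝ) (f : α → ℝ) : μ.E (fun a => f a / c) = μ.E f / c := by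
  simp only [div_eq_inv_mul, E_mul]

/-- Finiteness of `β` makes `ν.E` a finite weighted sum, which commutes with any linear functional;
for two merely finitely additive means this could fail. -/
theorem E_comm [Fintype β] (μ : Mean α) (ν : Mean β) (F : α → β → ℝ) :
    μ.E (fun a => ν.E (fun b => F a b)) = ν.E (fun b => μ.E (fun a => F a b)) := by
  classical
  have h : ∀ f : β → ℝ, ν.E f = ∑ b, f b * ν.E (fun j => if b = j then 1 else 0) := by
    intro f
    simpa using LinearMap.pi_apply_eq_sum_univ ν.E f
  rw [h]
  have h2 : (fun a => ν.E (fun b => F a b))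
      = ∑ b, (ν.E (fun j => if b = j then 1 else 0)) • (fun a => F a b) := by
    ext a
    rw [h]
    simp [mul_comm]
  rw [h2, map_sum]
  refine Finset.sum_congr rfl fun b _ => ?_
  rw [map_smul, smul_eq_mul, mul_comm]

/-- The point mass. -/
def pure (a : α) : Mean α where
  E := LinearMap.proj a
  mono _ _ h := h a
  one := rfl

@[simp] theorem pure_E (a : α) (f : α → ℝ) : (pure a).E f = f a := rfl

/-- The law of the second stage of a two-stage experiment. -/
def bind (μ : Mean α) (κ : α → Mean β) : Mean β where
  E := μ.E ∘ₗ LinearMap.pi fun a => (κ a).E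
  mono _ _ h := μ.mono _ _ fun a => (κ a).mono _ _ h
  one := by
    have : (LinearMap.pi fun a => (κ a).E) (fun _ => (1 : ℝ)) = fun _ => 1 := by
      ext a; exact (κ a).one
    rw [LinearMap.comp_apply, this, μ.one]

@[simp] theorem bind_E (μ : Mean α) (κ : α → Mean β) (f : β → ℝ) :
    (μ.bind κ).E f = μ.E fun a => (κ a).E f := rfl

/-- The uniform distribution on a nonempty finite set. -/
noncomputable def uniform (s : Finset α) (hs : s.Nonempty) : Mean α where
  E := (s.card : ℝ)⁻¹ • ∑ a ∈ s, LinearMap.proj a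
  mono f g h := by
    simp only [LinearMap.smul_apply, LinearMap.sum_apply, LinearMap.proj_apply, smul_eq_mul]
    gcongr
    exact h _
  one := by
    have : (s.card : ℝ) ≠ 0 := by exact_mod_cast hs.card_ne_zero
    simp [this]

theorem uniform_E (s : Finset α) (hs : s.Nonempty) (f : α → ℝ) :
    (uniform s hs).E f = (s.card : ℝ)⁻¹ * ∑ a ∈ s, f a := by
  simp [uniform]

/-- The mixture that follows `μ` with probability `θ` and `ν` otherwise. -/
noncomputable def mix (θ : ℝ) (h0 : 0 ≤ θ) (h1 : θ ≤ 1) (μ ν : Mean α) : Mean α where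
  E := θ • μ.E + (1 - θ) • ν.E
  mono f g h := by
    have := μ.mono f g h
    have := ν.mono f g h
    have : 0 ≤ 1 - θ := by linarith
    simp only [LinearMap.add_apply, LinearMap.smul_apply, smul_eq_mul]
    gcongr
  one := by simp [μ.one, ν.one]

theorem mix_E (θ : ℝ) (h0 : 0 ≤ θ) (h1 : θ ≤ 1) (μ ν : Mean α) (f : α → ℝ) :
    (mix θ h0 h1 μ ν).E f = θ * μ.E f + (1 - θ) * ν.E f := by
  simp [mix]

end Mean

/-! ### Partitionings, swaps and chunk counts -/

variable {U : Type*} [Fintype U] {w : ℕ}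

theorem Partitioning.chunk_injective :
    Function.Injective (Partitioning.chunk : Partitioning U w → U → Fin w) := by
  rintro ⟨f, _⟩ ⟨g, _⟩ h
  cases h
  rfl

instance : Finite (Partitioning U w) := Finite.of_injective _ Partitioning.chunk_injective

noncomputable instance : Fintype (Partitioning U w) := Fintype.ofFinite _

open Classical in
/-- The partitioning with the places of `x` and `y` exchanged. -/
noncomputable def Partitioning.swap (p : Partitioning U w) (x y : U) : Partitioning U w where
  chunk z := p.chunk (Equiv.swap x y z)
  valid i := by
    rw [← p.valid i]
    refine Finset.card_bij (fun z _ => Equiv.swap x y z) ?_ ?_ ?_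
    · intro z hz; simpa using hz
    · intro a _ b _ h; simpa using h
    · intro b hb; exact ⟨Equiv.swap x y b, by simpa using hb, by simp⟩

theorem Partitioning.swap_chunk_left (p : Partitioning U w) (x y : U) :
    (p.swap x y).chunk x = p.chunk y := by simp [Partitioning.swap]

theorem Partitioning.swap_chunk_right (p : Partitioning U w) (x y : U) :
    (p.swap x y).chunk y = p.chunk x := by simp [Partitioning.swap]

theorem Partitioning.swap_chunk_of_ne (p : Partitioning U w) {x y z : U} (hx : z ≠ x)
    (hy : z ≠ y) : (p.swap x y).chunk z = p.chunk z := by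
  classical
  simp [Partitioning.swap, Equiv.swap_apply_of_ne_of_ne hx hy]

/-- The set of elements in the chunk with index `k`. -/
def Partitioning.level (p : Partitioning U w) (k : ℕ) : Finset U :=
  univ.filter fun u => (p.chunk u : ℕ) = k

theorem Partitioning.card_level (p : Partitioning U w) {k : ℕ} (hk : k < w) :
    (p.level k).card = 2 ^ k := by
  rw [← p.valid ⟨k, hk⟩, Partitioning.level]
  congr 1
  ext u
  simp [Fin.ext_iff]

/-- Chunk sizes are geometric, so all chunks up to the largest one counted hold fewer than twice its
size many elements. -/
theorem Partitioning.card_le (q : Partitioning U w) (c M : ℕ) :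
    c * (univ.filter fun u => c * q.size u < M).card ≤ 2 * M := by
  classical
  set S := univ.filter fun u => c * q.size u < M with hS
  rcases S.eq_empty_or_nonempty with h | h
  · simp [h]
  obtain ⟨u, hu, hmax⟩ := S.exists_max_image (fun u => (q.chunk u : ℕ)) h
  have h1 : S.card ≤ ∑ i ∈ range ((q.chunk u : ℕ) + 1), 2 ^ i := by
    have hsub : S ⊆ (range ((q.chunk u : ℕ) + 1)).biUnion q.level := by
      intro v hv
      simp only [mem_biUnion, mem_range, Partitioning.level, mem_filter, mem_univ, true_and]
      exact ⟨_, Nat.lt_succ_iff.2 (hmax v hv), rfl⟩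
    refine (card_le_card hsub).trans (card_biUnion_le.trans (sum_le_sum fun i hi => ?_))
    have : i < w := lt_of_le_of_lt (Nat.lt_succ_iff.1 (mem_range.1 hi)) (q.chunk u).2
    rw [q.card_level this]
  have h2 : S.card < 2 ^ ((q.chunk u : ℕ) + 1) :=
    lt_of_le_of_lt h1 (Nat.geomSum_lt le_rfl (by simp))
  have h3 : c * q.size u < M := by simpa [hS] using hu
  calc c * S.card ≤ c * 2 ^ ((q.chunk u : ℕ) + 1) := by gcongr
    _ = 2 * (c * q.size u) := by rw [Partitioning.size, pow_succ]; ring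
    _ ≤ 2 * M := by omega

/-! ### Movement costs -/

open Classical in
theorem movementCost_eq (p q : Partitioning U w) :
    movementCost p q =
      ∑ x, if p.chunk x ≠ q.chunk x then max (p.size x) (q.size x) else 0 := by
  rw [movementCost, sum_filter]

theorem movementCost_self (p : Partitioning U w) : movementCost p p = 0 := by
  simp [movementCost]

theorem movementCost_triangle (p q s : Partitioning U w) :
    movementCost p s ≤ movementCost p q + movementCost q s := by
  classical
  simp only [movementCost_eq, ← sum_add_distrib]
  refine sum_le_sum fun x _ => ?_
  by_cases h1 : p.chunk x = q.chunk x
  · simp [h1, Partitioning.size]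
  · by_cases h2 : q.chunk x = s.chunk x
    · simp [h2, Partitioning.size]
    · simp only [ne_eq, h1, h2, not_false_eq_true, if_true]
      split_ifs <;> omega

theorem movementCost_swap_le (p : Partitioning U w) {x u : U} (h : p.size u ≤ p.size x) :
    movementCost p (p.swap x u) ≤ 2 * p.size x := by
  classical
  have h1 : (univ.filter fun z => p.chunk z ≠ (p.swap x u).chunk z) ⊆ {x, u} := by
    intro z hz
    simp only [mem_filter, mem_univ, true_and] at hz
    by_contra hc
    simp only [mem_insert, mem_singleton, not_or] at hc
    exact hz (p.swap_chunk_of_ne hc.1 hc.2).symm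
  have h2 : ∀ z ∈ ({x, u} : Finset U), max (p.size z) ((p.swap x u).size z) ≤ p.size x := by
    intro z hz
    simp only [mem_insert, mem_singleton] at hz
    rcases hz with rfl | rfl
    · simpa [Partitioning.size, p.swap_chunk_left] using h
    · simpa [Partitioning.size, p.swap_chunk_right] using h
  calc movementCost p (p.swap x u)
      ≤ ∑ z ∈ {x, u}, max (p.size z) ((p.swap x u).size z) := sum_le_sum_of_subset h1
    _ ≤ ({x, u} : Finset U).card • p.size x := sum_le_card_nsmul _ _ _ h2
    _ ≤ 2 * p.size x := by
      rw [smul_eq_mul]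
      exact Nat.mul_le_mul_right _ card_le_two

/-! ### The potential -/

/-- The contribution of an element in a chunk of size `a` of the algorithm and of size `b` of the
adversary. -/
def gap (c a b : ℕ) : ℝ := if c * b < a then (a : ℝ) else 0

theorem gap_nonneg (c a b : ℕ) : 0 ≤ gap c a b := by
  unfold gap; split_ifs <;> positivity

theorem gap_anti {c d : ℕ} (h : c ≤ d) (a b : ℕ) : gap d a b ≤ gap c a b := by
  have : c * b ≤ d * b := Nat.mul_le_mul_right _ h
  unfold gap
  split_ifs
  · exact le_rfl
  · omega
  · positivity
  · exact le_rfl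

/-- The potential: the total size of the elements that the algorithm holds in chunks more than `c`
times larger than those of the adversary. -/
def potential (c : ℕ) (p q : Partitioning U w) : ℝ := ∑ x, gap c (p.size x) (q.size x)

theorem potential_nonneg (c : ℕ) (p q : Partitioning U w) : 0 ≤ potential c p q :=
  sum_nonneg fun _ _ => gap_nonneg _ _ _

/-- This lets the threshold follow the running maximum of the request cardinalities at no cost. -/
theorem potential_anti {c d : ℕ} (h : c ≤ d) (p q : Partitioning U w) :
    potential d p q ≤ potential c p q :=
  sum_le_sum fun _ _ => gap_anti h _ _

theorem potential_self {c : ℕ} (hc : 1 ≤ c) (p : Partitioning U w) : potential c p p = 0 := by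
  refine sum_eq_zero fun x _ => ?_
  have : p.size x ≤ c * p.size x := Nat.le_mul_of_pos_left _ hc
  rw [gap, if_neg (by omega)]

/-- An element that newly contributes had `p.size x ≤ c * q.size x`, so its contribution is paid by
`c` times its own movement cost. -/
theorem potential_move_le (c : ℕ) (p q s : Partitioning U w) :
    potential c p s ≤ potential c p q + c * movementCost q s := by
  classical
  rw [movementCost_eq, potential, potential]
  push_cast
  rw [mul_sum, ← sum_add_distrib]
  refine sum_le_sum fun x _ => ?_
  by_cases h : q.chunk x = s.chunk x
  · simp [h, Partitioning.size]
  · rw [if_pos h]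
    by_cases h1 : c * q.size x < p.size x
    · have h2 : gap c (p.size x) (s.size x) ≤ p.size x := by
        unfold gap; split_ifs <;> simp
      have h3 : gap c (p.size x) (q.size x) = p.size x := by simp [gap, h1]
      have h4 : (0 : ℝ) ≤ c * max (q.size x : ℝ) (s.size x) := by positivity
      linarith
    · have h2 : gap c (p.size x) (s.size x) ≤ p.size x := by
        unfold gap; split_ifs <;> simp
      have h3 : (p.size x : ℝ) ≤ c * q.size x := by exact_mod_cast not_lt.1 h1
      have h4 : (c : ℝ) * q.size x ≤ c * max (q.size x : ℝ) (s.size x) := by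
        gcongr; exact le_max_left _ _
      have := gap_nonneg c (p.size x) (q.size x)
      linarith

theorem potential_swap (c : ℕ) (p q : Partitioning U w) {x u : U} (h : x ≠ u) :
    potential c (p.swap x u) q = potential c p q
      + (gap c (p.size u) (q.size x) - gap c (p.size x) (q.size x))
      + (gap c (p.size x) (q.size u) - gap c (p.size u) (q.size u)) := by
  classical
  have h1 : potential c (p.swap x u) q - potential c p q
      = ∑ z ∈ {x, u}, (gap c ((p.swap x u).size z) (q.size z) - gap c (p.size z) (q.size z)) := by
    rw [potential, potential, ← sum_sub_distrib]
    refine (sum_subset (subset_univ _) fun z _ hz => ?_).symm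
    simp only [mem_insert, mem_singleton, not_or] at hz
    simp [Partitioning.size, p.swap_chunk_of_ne hz.1 hz.2]
  rw [sum_pair h] at h1
  simp only [Partitioning.size, p.swap_chunk_left, p.swap_chunk_right] at h1 ⊢
  linarith

/-! ### The randomized algorithm -/

/-- Bring `x` from the chunk `k` to the chunk `0`, exchanging it in turn with a uniformly random
element of each smaller chunk. -/
noncomputable def fetch (x : U) : ℕ → Partitioning U w → Mean (Partitioning U w)
  | 0, p => Mean.pure p
  | k + 1, p =>
    if h : (p.level k).Nonempty then
      (Mean.uniform (p.level k) h).bind fun u => fetch x k (p.swap x u)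
    else Mean.pure p

/-- The swap out of chunk `k` costs at most `2 * 2 ^ k`, and these costs form a geometric series. -/
theorem fetch_movementCost_le (x : U) (k : ℕ) (p : Partitioning U w) (hp : (p.chunk x : ℕ) = k) :
    (fetch x k p).E (fun p' => (movementCost p p' : ℝ)) ≤ 4 * 2 ^ k := by
  induction k generalizing p with
  | zero => simp [fetch, movementCost_self]
  | succ k ih =>
    have hk : k < w := by have := (p.chunk x).2; omega
    have hne : (p.level k).Nonempty := by
      rw [← card_pos, p.card_level hk]; positivity
    rw [fetch, dif_pos hne, Mean.bind_E, Mean.uniform_E]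
    have hb : ∀ u ∈ p.level k,
        (fetch x k (p.swap x u)).E (fun p' => (movementCost p p' : ℝ)) ≤ 4 * 2 ^ (k + 1) := by
      intro u hu
      have hu' : (p.chunk u : ℕ) = k := by simpa [Partitioning.level] using hu
      have h1 := ih (p.swap x u) (by rw [p.swap_chunk_left, hu'])
      have h2 : movementCost p (p.swap x u) ≤ 2 * 2 ^ (k + 1) := by
        have := movementCost_swap_le p (x := x) (u := u) (by
          rw [Partitioning.size, Partitioning.size, hu', hp]
          exact Nat.pow_le_pow_right (by norm_num) (by omega))
        rwa [Partitioning.size, hp] at this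
      have h2' : (movementCost p (p.swap x u) : ℝ) ≤ 2 * 2 ^ (k + 1) := by exact_mod_cast h2
      have h3 : (fetch x k (p.swap x u)).E (fun p' => (movementCost p p' : ℝ))
          ≤ (fetch x k (p.swap x u)).E (fun p' => (movementCost p (p.swap x u) : ℝ)
            + (movementCost (p.swap x u) p' : ℝ)) :=
        Mean.mono _ _ _ fun p' => by exact_mod_cast movementCost_triangle _ _ _
      rw [Mean.E_add, Mean.E_const] at h3
      rw [pow_succ] at h2' ⊢
      linarith
    have hc : (0 : ℝ) < (p.level k).card := by exact_mod_cast hne.card_pos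
    rw [inv_mul_le_iff₀ hc]
    simpa [nsmul_eq_mul] using sum_le_card_nsmul _ _ _ hb

/-- Expected damage from raising a random element of chunk `k` by one level: by `card_le` at most `2
* 2 ^ (k + 1) / c` elements can contribute, each `2 ^ (k + 1)`, among `2 ^ k` choices. -/
theorem sum_gap_level_le {c : ℕ} (hc : 1 ≤ c) (p q : Partitioning U w) {k : ℕ} (hk : k < w) :
    ((p.level k).card : ℝ)⁻¹ * ∑ u ∈ p.level k, gap c (2 ^ (k + 1)) (q.size u)
      ≤ 8 / c * 2 ^ k := by
  have hc' : (0 : ℝ) < c := by exact_mod_cast hc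
  have h1 : ∑ u ∈ p.level k, gap c (2 ^ (k + 1)) (q.size u)
      ≤ ∑ u, gap c (2 ^ (k + 1)) (q.size u) :=
    sum_le_sum_of_subset_of_nonneg (subset_univ _) fun _ _ _ => gap_nonneg _ _ _
  have h2 : ∑ u, gap c (2 ^ (k + 1)) (q.size u)
      = (univ.filter fun u => c * q.size u < 2 ^ (k + 1)).card * (2 : ℝ) ^ (k + 1) := by
    simp only [gap]
    rw [← sum_filter]
    simp
  have h3 : (c : ℝ) * (univ.filter fun u => c * q.size u < 2 ^ (k + 1)).card
      ≤ 2 * 2 ^ (k + 1) := by exact_mod_cast q.card_le c (2 ^ (k + 1))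
  have h4 : ((univ.filter fun u => c * q.size u < 2 ^ (k + 1)).card : ℝ)
      ≤ 2 * 2 ^ (k + 1) / c := by
    rw [le_div_iff₀ hc']; linarith
  rw [p.card_level hk]
  push_cast
  rw [inv_mul_le_iff₀ (by positivity)]
  calc _ ≤ 2 * 2 ^ (k + 1) / c * (2 : ℝ) ^ (k + 1) := by
        rw [h2] at h1
        exact h1.trans (by gcongr)
    _ = _ := by rw [pow_succ]; ring

/-- The fetched element loses its contribution, ending in chunk 0 where it has none; the damages `8
/ c * 2 ^ i` for `i < k` sum to less than `8 / c * 2 ^ k`. -/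
theorem fetch_potential_le {c : ℕ} (hc : 1 ≤ c) (q : Partitioning U w) (x : U) (k : ℕ)
    (p : Partitioning U w) (hp : (p.chunk x : ℕ) = k) :
    (fetch x k p).E (fun p' => potential c p' q)
      ≤ potential c p q - gap c (2 ^ k) (q.size x) + 8 / c * 2 ^ k := by
  induction k generalizing p with
  | zero =>
    have h : 1 ≤ c * q.size x := Nat.mul_pos hc (by simp [Partitioning.size])
    have h1 : gap c (2 ^ 0) (q.size x) = 0 := by rw [gap, if_neg (by rw [pow_zero]; omega)]
    rw [h1, fetch, Mean.pure_E]
    have : (0 : ℝ) ≤ 8 / c * 2 ^ 0 := by positivity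
    linarith
  | succ k ih =>
    have hk : k < w := by have := (p.chunk x).2; omega
    have hne : (p.level k).Nonempty := by
      rw [← card_pos, p.card_level hk]; positivity
    rw [fetch, dif_pos hne, Mean.bind_E, Mean.uniform_E]
    have hb : ∀ u ∈ p.level k,
        (fetch x k (p.swap x u)).E (fun p' => potential c p' q) ≤
          (potential c p q - gap c (2 ^ (k + 1)) (q.size x) + 8 / c * 2 ^ k)
            + gap c (2 ^ (k + 1)) (q.size u) := by
      intro u hu
      have hu' : (p.chunk u : ℕ) = k := by simpa [Partitioning.level] using hu
      have hxu : x ≠ u := by rintro rfl; omega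
      have h1 := ih (p.swap x u) (by rw [p.swap_chunk_left, hu'])
      rw [potential_swap c p q hxu] at h1
      have hsx : p.size x = 2 ^ (k + 1) := by rw [Partitioning.size, hp]
      have hsu : p.size u = 2 ^ k := by rw [Partitioning.size, hu']
      rw [hsx, hsu] at h1
      have := gap_nonneg c (2 ^ k) (q.size u)
      linarith
    have hcard : (0 : ℝ) < (p.level k).card := by exact_mod_cast hne.card_pos
    have h5 := sum_gap_level_le hc p q hk
    have h6 := mul_le_mul_of_nonneg_left (sum_le_sum hb) (inv_nonneg.2 hcard.le)
    rw [sum_add_distrib, mul_add, sum_const, nsmul_eq_mul, inv_mul_cancel_left₀ hcard.ne'] at h6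
    refine h6.trans ?_
    rw [pow_succ (2 : ℝ)]
    linarith

theorem accessCost_le (p : Partitioning U w) (R : Request U) {x : U} (hx : x ∈ R.1) :
    accessCost p R ≤ p.size x := inf'_le _ hx

theorem size_pos (p : Partitioning U w) (x : U) : (0 : ℝ) < p.size x := by
  simp [Partitioning.size]

theorem fetchProb_le_one (p : Partitioning U w) (R : Request U) (x : {x // x ∈ R.1}) :
    (accessCost p R : ℝ) / p.size x ≤ 1 := by
  rw [div_le_one (size_pos p x)]
  exact_mod_cast accessCost_le p R x.2

/-- The memoryless randomized algorithm: a random element of the request is fetched with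
probability the access cost divided by its size. -/
noncomputable def randomStep (R : Request U) (p : Partitioning U w) : Mean (Partitioning U w) :=
  (Mean.uniform R.1.attach (R.2.attach)).bind fun x =>
    Mean.mix ((accessCost p R : ℝ) / p.size x) (by positivity) (fetchProb_le_one p R x)
      (fetch x.1 (p.chunk x) p) (Mean.pure p)

/-- The cost of serving `R` in `p` and then moving to `p'`. -/
def stepCost (R : Request U) (p p' : Partitioning U w) : ℝ :=
  accessCost p R + movementCost p p'

theorem stepCost_nonneg (R : Request U) (p p' : Partitioning U w) : 0 ≤ stepCost R p p' := by
  unfold stepCost; positivity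

/-- The fetch probability cancels the size in the fetch cost, leaving `4 * accessCost p R` whichever
element is drawn. -/
theorem randomStep_cost_le (R : Request U) (p : Partitioning U w) :
    (randomStep R p).E (stepCost R p) ≤ 5 * accessCost p R := by
  have hcard : (0 : ℝ) < R.1.attach.card := by exact_mod_cast R.2.attach.card_pos
  have h : ∀ x ∈ R.1.attach, (Mean.mix ((accessCost p R : ℝ) / p.size x) (by positivity)
      (fetchProb_le_one p R x) (fetch x.1 (p.chunk x) p) (Mean.pure p)).E
        (fun p' => (movementCost p p' : ℝ)) ≤ 4 * accessCost p R := by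
    intro x _
    have h1 := fetch_movementCost_le x.1 _ p rfl
    have h2 : (2 : ℝ) ^ (p.chunk x : ℕ) = p.size x := by simp [Partitioning.size]
    rw [h2] at h1
    rw [Mean.mix_E, Mean.pure_E, movementCost_self]
    have h3 := mul_le_mul_of_nonneg_left h1
      (show 0 ≤ (accessCost p R : ℝ) / p.size x by positivity)
    have h4 : (accessCost p R : ℝ) / p.size x * (4 * p.size x) = 4 * accessCost p R := by
      have := (size_pos p x).ne'
      field_simp
    simp only [Nat.cast_zero, mul_zero, add_zero]
    linarith
  have h1 : (randomStep R p).E (fun p' => (movementCost p p' : ℝ)) ≤ 4 * accessCost p R := by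
    rw [randomStep, Mean.bind_E, Mean.uniform_E, inv_mul_le_iff₀ hcard]
    simpa [nsmul_eq_mul] using sum_le_card_nsmul _ _ _ h
  have h2 : stepCost R p = fun p' => (accessCost p R : ℝ) + movementCost p p' := rfl
  rw [h2, Mean.E_add, Mean.E_const]
  linarith

/-- Every element of the request yields a nonnegative expected gain, so only that of `y` is kept; it
carries the factor `1 / |R|`. -/
theorem randomStep_potential_le {c : ℕ} (hc : 1 ≤ c) (R : Request U) (p q : Partitioning U w)
    {y : U} (hy : y ∈ R.1) :
    (randomStep R p).E (fun p' => potential c p' q) ≤ potential c p q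
      + 8 / c * accessCost p R
      - (R.1.card : ℝ)⁻¹ * (accessCost p R * (gap c (p.size y) (q.size y) / p.size y)) := by
  have hcard : (0 : ℝ) < R.1.attach.card := by exact_mod_cast R.2.attach.card_pos
  have h : ∀ x ∈ R.1.attach, (Mean.mix ((accessCost p R : ℝ) / p.size x) (by positivity)
      (fetchProb_le_one p R x) (fetch x.1 (p.chunk x) p) (Mean.pure p)).E
        (fun p' => potential c p' q) ≤ (potential c p q + 8 / c * accessCost p R)
          + -(accessCost p R * (gap c (p.size x) (q.size x) / p.size x)) := by
    intro x _
    have h1 := fetch_potential_le hc q x.1 _ p rfl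
    have h2 : (2 : ℝ) ^ (p.chunk x : ℕ) = p.size x := by simp [Partitioning.size]
    have h2' : 2 ^ (p.chunk x : ℕ) = p.size x := rfl
    rw [h2, h2'] at h1
    rw [Mean.mix_E, Mean.pure_E]
    have h3 := mul_le_mul_of_nonneg_left h1
      (show 0 ≤ (accessCost p R : ℝ) / p.size x by positivity)
    have h4 : (accessCost p R : ℝ) / p.size x *
        (potential c p q - gap c (p.size x) (q.size x) + 8 / c * p.size x)
        = (accessCost p R : ℝ) / p.size x * potential c p q
          - accessCost p R * (gap c (p.size x) (q.size x) / p.size x)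
          + 8 / c * accessCost p R := by
      have := (size_pos p x).ne'
      have : (c : ℝ) ≠ 0 := by positivity
      field_simp
    linarith
  have h5 := mul_le_mul_of_nonneg_left (sum_le_sum h) (inv_nonneg.2 hcard.le)
  rw [sum_add_distrib, mul_add, sum_const, nsmul_eq_mul, inv_mul_cancel_left₀ hcard.ne',
    sum_neg_distrib] at h5
  rw [randomStep, Mean.bind_E, Mean.uniform_E]
  refine h5.trans ?_
  have h6 : (accessCost p R : ℝ) * (gap c (p.size y) (q.size y) / p.size y)
      ≤ ∑ x ∈ R.1.attach, (accessCost p R : ℝ) * (gap c (p.size x) (q.size x) / p.size x) :=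
    single_le_sum (s := R.1.attach) (a := ⟨y, hy⟩) (f := fun x : {x // x ∈ R.1} =>
        (accessCost p R : ℝ) * (gap c (p.size x) (q.size x) / p.size x))
      (fun x _ => mul_nonneg (Nat.cast_nonneg _)
        (div_nonneg (gap_nonneg _ _ _) (size_pos p x).le)) (mem_attach _ ⟨y, hy⟩)
  have h7 := mul_le_mul_of_nonneg_left h6 (inv_nonneg.2 hcard.le)
  rw [card_attach] at h7 ⊢
  linarith

/-- The amortized cost of the randomized algorithm against a motionless adversary. -/
theorem randomStep_amortized {r : ℕ} (R : Request U) (hr : R.1.card ≤ r)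
    (p q : Partitioning U w) :
    (randomStep R p).E (fun p' => stepCost R p p' / (10 * r) + potential (16 * r) p' q)
      ≤ potential (16 * r) p q + 16 * r * accessCost q R := by
  have hR : 0 < R.1.card := R.2.card_pos
  have hr1 : 1 ≤ r := by omega
  have hr0 : (1 : ℝ) ≤ r := by exact_mod_cast hr1
  obtain ⟨y, hy, hyq⟩ : ∃ y ∈ R.1, accessCost q R = q.size y := exists_mem_eq_inf' R.2 _
  have h1 := randomStep_cost_le R p
  have h2 := randomStep_potential_le (c := 16 * r) (by omega) R p q hy
  rw [Mean.E_add, Mean.E_div]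
  set l : ℝ := (accessCost p R : ℝ)
  have hl0 : 0 ≤ l := by positivity
  -- The constants 10 and 16 make the scaled cost and the damage `l / (2 * r)` each, so together
  -- they match the gain `l / r`.
  have h3 : (randomStep R p).E (stepCost R p) / (10 * r) ≤ l / (2 * r) := by
    rw [div_le_div_iff₀ (by positivity) (by positivity)]
    nlinarith
  have h4 : 8 / ((16 * r : ℕ) : ℝ) * l = l / (2 * r) := by
    push_cast; field_simp; ring
  rw [h4] at h2
  have h5 : l / (2 * r) + l / (2 * r) = l / r := by field_simp; norm_num
  rcases lt_or_ge (16 * r * q.size y) (p.size y) with hb | hb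
  · have h6 : gap (16 * r) (p.size y) (q.size y) / p.size y = 1 := by
      rw [gap, if_pos hb, div_self (size_pos p y).ne']
    rw [h6] at h2
    have h7 : l / r ≤ (R.1.card : ℝ)⁻¹ * (l * 1) := by
      rw [mul_one, mul_comm, ← div_eq_mul_inv]
      have : (R.1.card : ℝ) ≤ r := by exact_mod_cast hr
      have : (0 : ℝ) < R.1.card := by exact_mod_cast hR
      gcongr
    have h8 : (0 : ℝ) ≤ 16 * r * accessCost q R := by positivity
    linarith
  · have h6 : 0 ≤ (R.1.card : ℝ)⁻¹ * (l * (gap (16 * r) (p.size y) (q.size y) / p.size y)) :=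
      mul_nonneg (by positivity) (mul_nonneg hl0
        (div_nonneg (gap_nonneg _ _ _) (size_pos p y).le))
    have h7 : l ≤ 16 * r * accessCost q R := by
      rw [hyq, show l = (accessCost p R : ℝ) from rfl]
      exact_mod_cast (accessCost_le p R hy).trans hb
    have h8 : l / r ≤ l := div_le_self hl0 hr0
    linarith

/-- The adversary moves after the algorithm's step, and `potential_move_le` charges the move to it.
-/
theorem randomStep_amortized_move {r : ℕ} (R : Request U) (hr : R.1.card ≤ r)
    (p q q' : Partitioning U w) :
    (randomStep R p).E (fun p' => stepCost R p p' / (10 * r) + potential (16 * r) p' q')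
      ≤ potential (16 * r) p q + 16 * r * stepCost R q q' := by
  have h1 := randomStep_amortized R hr p q
  have h2 : (randomStep R p).E (fun p' => stepCost R p p' / (10 * r) + potential (16 * r) p' q')
      ≤ (randomStep R p).E (fun p' => (stepCost R p p' / (10 * r) + potential (16 * r) p' q)
        + 16 * r * movementCost q q') :=
    Mean.mono _ _ _ fun p' => by
      have := potential_move_le (16 * r) p' q q'
      push_cast at this
      linarith
  rw [Mean.E_add _ (fun p' => stepCost R p p' / (10 * r) + potential (16 * r) p' q),
    Mean.E_const] at h2
  rw [stepCost, mul_add]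
  linarith

/-! ### The deterministic algorithm -/

/-- The memory of the deterministic algorithm: its partitioning, the law of the partitioning of
the randomized algorithm, and the largest cardinality of a request so far. -/
structure Memory (U : Type*) [Fintype U] (w : ℕ) where
  /-- The current partitioning. -/
  pos : Partitioning U w
  /-- The law of the partitioning of the randomized algorithm. -/
  law : Mean (Partitioning U w)
  /-- The largest cardinality of a request so far (at least `1`). -/
  width : ℕ

/-- The memory before the first request. -/
def Memory.start (p : Partitioning U w) : Memory U w := ⟨p, Mean.pure p, 1⟩

/-- The quantity that the deterministic algorithm minimizes. -/
noncomputable def target (R : Request U) (r : ℕ) (law' : Mean (Partitioning U w))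
    (p p' : Partitioning U w) : ℝ :=
  stepCost R p p' / (10 * r) + law'.E fun h => potential (16 * r) p' h

theorem exists_target_min (R : Request U) (r : ℕ) (law' : Mean (Partitioning U w))
    (p : Partitioning U w) : ∃ p', ∀ s, target R r law' p p' ≤ target R r law' p s :=
  haveI : Nonempty (Partitioning U w) := ⟨p⟩
  Finite.exists_min _

/-- The reaction to a request. -/
noncomputable def Memory.step (m : Memory U w) (R : Request U) : Memory U w where
  pos := (exists_target_min R (max m.width R.1.card) (m.law.bind (randomStep R)) m.pos).choose
  law := m.law.bind (randomStep R)
  width := max m.width R.1.card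

/-- The potential of the deterministic algorithm against the randomized one. -/
noncomputable def Memory.innerPotential (m : Memory U w) : ℝ :=
  m.law.E fun h => potential (16 * m.width) m.pos h

/-- The potential of the randomized algorithm against an adversary. -/
noncomputable def Memory.outerPotential (m : Memory U w) (q : Partitioning U w) : ℝ :=
  m.law.E fun h => potential (16 * m.width) h q

/-- The expected cost of the randomized algorithm for serving `R`. -/
noncomputable def Memory.randomCost (m : Memory U w) (R : Request U) : ℝ :=
  m.law.E fun h => (randomStep R h).E (stepCost R h)

theorem Mean.E_nonneg {α : Type*} (μ : Mean α) (f : α → ℝ) (h : ∀ a, 0 ≤ f a) : 0 ≤ μ.E f := by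
  have := μ.mono (fun _ => 0) f h
  rwa [μ.E_const] at this

theorem Memory.randomCost_nonneg (m : Memory U w) (R : Request U) : 0 ≤ m.randomCost R :=
  Mean.E_nonneg _ _ fun _ => Mean.E_nonneg _ _ fun _ => stepCost_nonneg _ _ _

theorem Memory.outer_step (m : Memory U w) (R : Request U) (q q' : Partitioning U w) :
    (m.step R).outerPotential q' + m.randomCost R / (10 * (m.step R).width)
      ≤ m.outerPotential q + 16 * (m.step R).width * stepCost R q q' := by
  set r := (m.step R).width with hr
  have hR : R.1.card ≤ r := le_max_right _ _
  have hm : 16 * m.width ≤ 16 * r := Nat.mul_le_mul_left _ (le_max_left _ _)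
  have h1 : m.law.E (fun h => (randomStep R h).E
        (fun p' => stepCost R h p' / (10 * r) + potential (16 * r) p' q'))
      ≤ m.law.E (fun h => potential (16 * m.width) h q + 16 * r * stepCost R q q') :=
    Mean.mono _ _ _ fun h => (randomStep_amortized_move R hR h q q').trans
      (by have := potential_anti hm h q; linarith)
  simp only [Mean.E_add, Mean.E_const, Mean.E_div] at h1
  have h2 : (m.step R).outerPotential q'
      = m.law.E fun h => (randomStep R h).E fun p' => potential (16 * r) p' q' := rfl
  rw [h2, Memory.randomCost, Memory.outerPotential]
  linarith

theorem Memory.inner_step (m : Memory U w) (R : Request U) :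
    (m.step R).innerPotential + stepCost R m.pos (m.step R).pos / (10 * (m.step R).width)
      ≤ m.innerPotential + 16 * (m.step R).width * m.randomCost R := by
  set r := (m.step R).width with hr
  have hR : R.1.card ≤ r := le_max_right _ _
  have hm : 16 * m.width ≤ 16 * r := Nat.mul_le_mul_left _ (le_max_left _ _)
  have hmin : ∀ s, target R r (m.law.bind (randomStep R)) m.pos (m.step R).pos
      ≤ target R r (m.law.bind (randomStep R)) m.pos s :=
    (exists_target_min R r (m.law.bind (randomStep R)) m.pos).choose_spec
  -- A minimum is at most the average over the randomized reaction from the same position.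
  have h1 : target R r (m.law.bind (randomStep R)) m.pos (m.step R).pos
      ≤ (randomStep R m.pos).E (target R r (m.law.bind (randomStep R)) m.pos) := by
    rw [← Mean.E_const (randomStep R m.pos) (target R r _ m.pos (m.step R).pos)]
    exact Mean.mono _ _ _ hmin
  have h2 : (randomStep R m.pos).E (target R r (m.law.bind (randomStep R)) m.pos)
      = (m.law.bind fun h => randomStep R h).E fun h' => (randomStep R m.pos).E fun p' =>
          stepCost R m.pos p' / (10 * r) + potential (16 * r) p' h' := by
    -- The two random steps are independent, so the tracked step can be fixed first and the
    -- amortized bound applied to each of its outcomes.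
    rw [← Mean.E_comm]
    congr 1
    ext p'
    rw [Mean.E_add, Mean.E_const]
    rfl
  have h3 : (m.law.bind fun h => randomStep R h).E (fun h' => (randomStep R m.pos).E fun p' =>
          stepCost R m.pos p' / (10 * r) + potential (16 * r) p' h')
      ≤ m.law.E fun h => potential (16 * m.width) m.pos h
          + 16 * r * (randomStep R h).E (stepCost R h) := by
    rw [Mean.bind_E]
    refine Mean.mono _ _ _ fun h => ?_
    have h4 : (randomStep R h).E (fun h' => (randomStep R m.pos).E fun p' =>
          stepCost R m.pos p' / (10 * r) + potential (16 * r) p' h')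
        ≤ (randomStep R h).E fun h' =>
          potential (16 * m.width) m.pos h + 16 * r * stepCost R h h' :=
      Mean.mono _ _ _ fun h' => (randomStep_amortized_move R hR m.pos h h').trans
        (by have := potential_anti hm m.pos h; linarith)
    rw [Mean.E_add, Mean.E_const, Mean.E_mul] at h4
    exact h4
  rw [Mean.E_add, Mean.E_mul] at h3
  have h5 : target R r (m.law.bind (randomStep R)) m.pos (m.step R).pos
      = stepCost R m.pos (m.step R).pos / (10 * r) + (m.step R).innerPotential := rfl
  have h6 : m.innerPotential = m.law.E (potential (16 * m.width) m.pos) := rfl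
  rw [h6, Memory.randomCost]
  linarith

/-- The deterministic algorithm. -/
noncomputable def derandomized (U : Type*) [Fintype U] (w : ℕ) : OnlineAlgorithm U w where
  next p past R := (((past.foldl Memory.step (Memory.start p)).step R)).pos

/-! ### Running the algorithm on an input -/

/-- The memory of the deterministic algorithm after `n` requests. -/
noncomputable def memoryAt (I : Input U w) (n : ℕ) : Memory U w :=
  (I.requests.take n).foldl Memory.step (Memory.start I.init)

theorem memoryAt_succ (I : Input U w) (t : Fin I.requests.length) :
    memoryAt I (t + 1) = (memoryAt I t).step (I.requests.get t) := by
  rw [memoryAt, memoryAt, ← List.take_concat_get' _ _ t.2, List.foldl_append]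
  rfl

theorem derandomized_run (I : Input U w) (i : Fin (I.requests.length + 1)) :
    ((derandomized U w).run I).p i = (memoryAt I i).pos := by
  induction i using Fin.cases with
  | zero => rfl
  | succ t =>
    rw [Fin.val_succ, memoryAt_succ]
    rfl

theorem card_le_maxCard (I : Input U w) (t : Fin I.requests.length) :
    (I.requests.get t).1.card ≤ I.maxCard :=
  le_sup (f := fun t : Fin I.requests.length => (I.requests.get t).1.card) (mem_univ t)

theorem width_memoryAt_le (I : Input U w) {r : ℕ} (h1 : 1 ≤ r) (hr : I.maxCard ≤ r)
    (i : Fin (I.requests.length + 1)) : (memoryAt I i).width ≤ r := by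
  induction i using Fin.induction with
  | zero => exact h1
  | succ t ih =>
    rw [Fin.val_succ, memoryAt_succ]
    exact max_le ih ((card_le_maxCard I t).trans hr)

theorem one_le_width_memoryAt (I : Input U w) (i : Fin (I.requests.length + 1)) :
    1 ≤ (memoryAt I i).width := by
  induction i using Fin.induction with
  | zero => exact le_rfl
  | succ t ih =>
    rw [Fin.val_succ, memoryAt_succ]
    exact le_max_of_le_left ih

/-! ### Telescoping and the competitive ratio -/

theorem sum_le_of_amortized {m : ℕ} (ψ : Fin (m + 1) → ℝ) (a b : Fin m → ℝ)
    (h0 : ψ 0 = 0) (hlast : 0 ≤ ψ (Fin.last m))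
    (h : ∀ t : Fin m, ψ t.succ + a t ≤ ψ t.castSucc + b t) : ∑ t, a t ≤ ∑ t, b t := by
  have h1 : ∑ t : Fin m, (ψ t.succ - ψ t.castSucc) = ψ (Fin.last m) - ψ 0 := by
    rw [sum_sub_distrib]
    have h2 := Fin.sum_univ_succ ψ
    have h3 := Fin.sum_univ_castSucc ψ
    linarith
  have h2 : ∑ t, a t ≤ ∑ t, (b t - (ψ t.succ - ψ t.castSucc)) :=
    sum_le_sum fun t _ => by have := h t; linarith
  rw [sum_sub_distrib, h1, h0] at h2
  linarith

/-- Amortization with a slowly growing ratio. -/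
theorem sum_le_of_amortized_width {m r : ℕ} (ψ : Fin (m + 1) → ℝ) (a b : Fin m → ℝ)
    (v : Fin m → ℕ) (hv1 : ∀ t, 1 ≤ v t) (hvr : ∀ t, v t ≤ r) (ha : ∀ t, 0 ≤ a t)
    (hb : ∀ t, 0 ≤ b t) (h0 : ψ 0 = 0) (hlast : 0 ≤ ψ (Fin.last m))
    (h : ∀ t, ψ t.succ + a t / (10 * v t) ≤ ψ t.castSucc + 16 * v t * b t) (hr : 1 ≤ r) :
    ∑ t, a t ≤ 160 * (r : ℝ) ^ 2 * ∑ t, b t := by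
  have h1 : ∑ t, a t / (10 * r) ≤ ∑ t, 16 * r * b t := by
    refine sum_le_of_amortized ψ _ _ h0 hlast fun t => ?_
    have hv : (v t : ℝ) ≤ r := by exact_mod_cast hvr t
    have hv' : (1 : ℝ) ≤ v t := by exact_mod_cast hv1 t
    have h2 : a t / (10 * r) ≤ a t / (10 * v t) := by
      have := ha t
      gcongr
    have h3 : 16 * v t * b t ≤ 16 * r * b t := by
      have := hb t
      gcongr
    have := h t
    linarith
  have hr' : (1 : ℝ) ≤ r := by exact_mod_cast hr
  rw [← sum_div, ← mul_sum, div_le_iff₀ (by positivity)] at h1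
  refine h1.trans_eq ?_
  ring

theorem solution_cost_eq {I : Input U w} (s : Solution I) :
    (s.cost : ℝ) = ∑ t : Fin I.requests.length,
      stepCost (I.requests.get t) (s.p t.castSucc) (s.p t.succ) := by
  simp [Solution.cost, stepCost]

theorem derandomized_cost_le (I : Input U w) (s : Solution I) {r : ℕ} (h1 : 1 ≤ r)
    (hr : I.maxCard ≤ r) :
    ((derandomized U w).cost I : ℝ) ≤ 25600 * (r : ℝ) ^ 4 * s.cost := by
  have hv1 : ∀ t : Fin I.requests.length, 1 ≤ (memoryAt I t.succ).width :=
    fun t => one_le_width_memoryAt I t.succ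
  have hvr : ∀ t : Fin I.requests.length, (memoryAt I t.succ).width ≤ r :=
    fun t => width_memoryAt_le I h1 hr t.succ
  have hin : ((derandomized U w).cost I : ℝ) ≤ 160 * (r : ℝ) ^ 2 *
      ∑ t : Fin I.requests.length, (memoryAt I t).randomCost (I.requests.get t) := by
    rw [OnlineAlgorithm.cost, solution_cost_eq]
    refine sum_le_of_amortized_width (fun i => (memoryAt I i).innerPotential) _ _
      (fun t => (memoryAt I t.succ).width) hv1 hvr (fun _ => stepCost_nonneg _ _ _)
      (fun _ => Memory.randomCost_nonneg _ _) (potential_self le_add_self I.init)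
      (Mean.E_nonneg _ _ fun _ => potential_nonneg _ _ _) (fun t => ?_) h1
    rw [derandomized_run, derandomized_run, Fin.val_succ, memoryAt_succ]
    exact Memory.inner_step _ _
  have hout : ∑ t : Fin I.requests.length, (memoryAt I t).randomCost (I.requests.get t)
      ≤ 160 * (r : ℝ) ^ 2 * s.cost := by
    rw [solution_cost_eq]
    refine sum_le_of_amortized_width (fun i => (memoryAt I i).outerPotential (s.p i)) _ _
      (fun t => (memoryAt I t.succ).width) hv1 hvr
      (fun _ => Memory.randomCost_nonneg _ _) (fun _ => stepCost_nonneg _ _ _) ?_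
      (Mean.E_nonneg _ _ fun _ => potential_nonneg _ _ _) (fun t => ?_) h1
    · rw [s.start]
      exact potential_self le_add_self I.init
    · rw [Fin.val_succ, memoryAt_succ]
      exact Memory.outer_step _ _ _ _
  calc ((derandomized U w).cost I : ℝ) ≤ 160 * (r : ℝ) ^ 2 * (160 * (r : ℝ) ^ 2 * s.cost) :=
        hin.trans (by gcongr)
    _ = _ := by ring

theorem derandomized_isCompetitive (U : Type*) [Fintype U] (w : ℕ) :
    (derandomized U w).IsCompetitive (fun r => 25600 * (r : ℝ) ^ 4) 0 := by
  intro I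
  obtain ⟨s, hs⟩ := (isLeast_opt I).1
  rw [add_zero, ← hs]
  rcases Nat.eq_zero_or_pos I.requests.length with h | h
  -- Without requests `maxCard` is 0 and the bound `1 ≤ r` fails, but the cost is 0 too.
  · have : IsEmpty (Fin I.requests.length) := by rw [h]; infer_instance
    rw [OnlineAlgorithm.cost, Solution.cost, univ_eq_empty, sum_empty, Nat.cast_zero]
    positivity
  · exact derandomized_cost_le I s
      ((card_pos.2 (I.requests.get ⟨0, h⟩).2).trans_le (card_le_maxCard I ⟨0, h⟩)) le_rfl

end ExpCaching

theorem mainTheorem3 :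
    ∃ C ξ : ℝ, ∀ (U : Type*) [Fintype U] (w : ℕ), 1 ≤ w → Fintype.card U = 2 ^ w - 1 →
      ∃ A : ExpCaching.OnlineAlgorithm U w,
        A.IsCompetitive (fun r => C * (r : ℝ) ^ 4) ξ :=
  ⟨25600, 0, fun U _ w _ _ =>
    ⟨ExpCaching.derandomized U w, ExpCaching.derandomized_isCompetitive U w⟩⟩
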